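/- **Theorem (Uniform Low Basis Theorem).** Conventions. Let $\langle\cdot,\cdot\rangle$ be a computable pairing on $\mathbb{N}$, and for $p_0,p_1,\dots\in\mathbb{N}^{\mathbb{N}}$ let $\langle p_0,p_1,\dots\rangle\in\mathbb{N}^{\mathbb{N}}$ be the sequence with $\langle p_0,p_1,\dots\rangle(\langle i,k\rangle)=p_i(k)$. A partial function $F:\subseteq\mathbb{N}^{\mathbb{N}}\to\mathbb{N}^{\mathbb{N}}$ is computable if a single oracle machine computes $F(p)(n)$ from the oracle $p$ and the input $n$, for all $p\in\mathrm{dom}(F)$ and $n\in\mathbb{N}$. Let $\lim:\subseteq\mathbb{N}^{\mathbb{N}}\to\mathbb{N}^{\mathbb{N}}$, $\langle p_0,p_1,\dots\rangle\mapsto\lim_{i\to\infty}p_i$, be the limit in Baire space (defined when it exists). Let $(U_n)_{n\in\mathbb{N}}$ be a standard enumeration of the c.e. open subsets of $\mathbb{N}^{\mathbb{N}}$, let $J:\mathbb{N}^{\mathbb{N}}\to\mathbb{N}^{\mathbb{N}}$ be the Turing jump operator, $J(p)(n)=1$ if $p\in U_n$ and $J(p)(n)=0$ otherwise; $J$ is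 injective, and $J^{-1}$ denotes its partial inverse. Put $L:=J^{-1}\circ\lim:\subseteq\mathbb{N}^{\mathbb{N}}\to\mathbb{N}^{\mathbb{N}}$. A representation of a set $X$ is a surjective partial function $\delta:\subseteq\mathbb{N}^{\mathbb{N}}\to X$. Its low representation is $\delta^\vee:=\delta\circ J^{-1}\circ\lim$. For a partial multi-valued function $f:\subseteq X\rightrightarrows Y$ between represented spaces $(X,\delta_X)$, $(Y,\delta_Y)$, a realizer of $f$ is a partial function $F:\subseteq\mathbb{N}^{\mathbb{N}}\to\mathbb{N}^{\mathbb{N}}$ with $\delta_Y(F(p))\in f(\delta_X(p))$ for all $p\in\mathrm{dom}(f\circ\delta_X)$; $f$ is $(\delta_X,\delta_Y)$-computable if it has a computable realizer, and low computable if it is $(\delta_X,\delta_Y^\vee)$-computable. For multi-valued functions $f,g$ between represented spaces, $f\le_{\mathrm{sW}}g$ means that there are computable $K,H:\subseteq\mathbb{N}^{\mathbb{N}}\to\mathbb{N}^{\mathbb{N}}$ such that $K\circ G\circ H$ is a realizer of $f$ for every realizer $G$ of $g$. Baire space $\mathbb{N}^{\mathbb{N}}$ is represented by the identity, and Cantor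 space $2^{\mathbb{N}}$ by the identity restricted to binary sequences. The closed subsets of $2^{\mathbb{N}}$ are represented by negative information: $p$ is a name of $A$ if $p$ is a (potentially empty) enumeration of finite binary words $w_i$ with $A=2^{\mathbb{N}}\setminus\bigcup_i w_i2^{\mathbb{N}}$. Closed choice $\mathsf{C}_{2^{\mathbb{N}}}$ is the multi-valued function that maps a non-empty closed set $A\subseteq 2^{\mathbb{N}}$ to an arbitrary point of $A$. Claim. 1. $\mathsf{C}_{2^{\mathbb{N}}}$ is low computable. 2. Explicitly: there is a single computable partial function $F:\subseteq\mathbb{N}^{\mathbb{N}}\to\mathbb{N}^{\mathbb{N}}$ such that, for every name $p$ of a non-empty closed set $A\subseteq2^{\mathbb{N}}$, $F(p)=\langle p_0,p_1,\dots\rangle$ is defined and there is a point $x\in A$ with $\lim_{i\to\infty}p_i=J(x)$. 3. Consequently, $\mathsf{C}_{2^{\mathbb{N}}}\le_{\mathrm{sW}}L$. -/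

import Mathlib

open Set Filter Topology TopologicalSpace Encodable

noncomputable section

/-! ### Words, cylinders, Baire space and Cantor space -/

/-- Baire space: the sequences of natural numbers, with the product topology. -/
abbrev Baire : Type := ℕ → ℕ

/-- Cantor space: the binary sequences, with the product topology. -/
abbrev Cantor : Type := ℕ → Bool

/-- A binary sequence, viewed as a point of Baire space. -/
def Cantor.toBaire (x : Cantor) : Baire := fun n => (x n).toNat

/-- The initial segment `x 0, …, x (k - 1)` of a sequence. -/
def initSeg {α : Type} (x : ℕ → α) (k : ℕ) : List α := (List.range k).map x

/-- The set of all sequences that extend the word `w`. -/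
def wordCylinder {α : Type} (w : List α) : Set (ℕ → α) := {x | initSeg x w.length = w}

theorem initSeg_mem {α : Type} (x : ℕ → α) (k : ℕ) : x ∈ wordCylinder (initSeg x k) := by
  simp [wordCylinder, initSeg]

theorem initSeg_eq_iff {α : Type} (x y : ℕ → α) (k : ℕ) :
    initSeg x k = initSeg y k ↔ ∀ i < k, x i = y i := by
  simp [initSeg]

theorem mem_wordCylinder_initSeg {α : Type} (x y : ℕ → α) (k : ℕ) :
    y ∈ wordCylinder (initSeg x k) ↔ ∀ i < k, y i = x i := by
  rw [← initSeg_eq_iff]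
  simp [wordCylinder, initSeg]

theorem isOpen_wordCylinder {α : Type} [TopologicalSpace α] [DiscreteTopology α] (w : List α) :
    IsOpen (wordCylinder w : Set (ℕ → α)) := by
  rw [isOpen_iff_mem_nhds]
  intro x hx
  have hx' : initSeg x w.length = w := hx
  refine Filter.mem_of_superset ((PiNat.isOpen_cylinder (fun _ => α) x w.length).mem_nhds
    (PiNat.self_mem_cylinder x w.length)) ?_
  intro y hy
  rw [← hx', mem_wordCylinder_initSeg]
  exact fun i hi => hy i hi

/-! ### Computability on Baire space -/

/-- The partial recursive functionals `Φ : ℕ^ℕ × ℕ ⇀ ℕ`: what a single oracle machine computes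
from the oracle `p` and the number `n`. This is the smallest class that contains the basic
functions and evaluation of the oracle and is closed under pairing, composition, primitive
recursion and minimisation, uniformly in the oracle. -/
inductive RecFunctional : (Baire → ℕ →. ℕ) → Prop
  | zero : RecFunctional fun _ _ => Part.some 0
  | succ : RecFunctional fun _ n => Part.some (n + 1)
  | left : RecFunctional fun _ n => Part.some n.unpair.1
  | right : RecFunctional fun _ n => Part.some n.unpair.2
  | oracle : RecFunctional fun p n => Part.some (p n)
  | pair {Φ Ψ : Baire → ℕ →. ℕ} (hΦ : RecFunctional Φ) (hΨ : RecFunctional Ψ) :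
      RecFunctional fun p n => Nat.pair <$> Φ p n <*> Ψ p n
  | comp {Φ Ψ : Baire → ℕ →. ℕ} (hΦ : RecFunctional Φ) (hΨ : RecFunctional Ψ) :
      RecFunctional fun p n => Ψ p n >>= Φ p
  | prec {Φ Ψ : Baire → ℕ →. ℕ} (hΦ : RecFunctional Φ) (hΨ : RecFunctional Ψ) :
      RecFunctional fun p m =>
        m.unpair.2.rec (Φ p m.unpair.1) fun y IH => do
          let i ← IH
          Ψ p (Nat.pair m.unpair.1 (Nat.pair y i))
  | rfind {Φ : Baire → ℕ →. ℕ} (hΦ : RecFunctional Φ) :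
      RecFunctional fun p a => Nat.rfind fun n => (fun m => m = 0) <$> Φ p (Nat.pair a n)

/-- A partial function on Baire space is computable if one oracle machine computes, from every
`p` in the domain and every `n`, the value `F(p)(n)`. -/
def BaireComputable (F : Baire →. Baire) : Prop :=
  ∃ Φ : Baire → ℕ →. ℕ, RecFunctional Φ ∧ ∀ p, ∀ q ∈ F p, ∀ n, q n ∈ Φ p n

/-! ### Represented spaces, realizers, reducibility -/

/-- A representation of `X`: a surjective partial function from Baire space onto `X`. -/
structure BaireRepresentation (X : Type) where
  /-- the underlying partial function -/
  toPFun : Baire →. X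
  surj : ∀ x, ∃ p, x ∈ toPFun p

/-- A partial multi-valued function; its domain is the set of `x` with `f x` non-empty. -/
abbrev MultiFun (X Y : Type) : Type := X → Set Y

/-- The domain of a multi-valued function. -/
def MultiFun.dom {X Y : Type} (f : MultiFun X Y) : Set X := {x | (f x).Nonempty}

/-- A single-valued partial function, viewed as a multi-valued one. -/
def PFun.toMultiFun {X Y : Type} (f : X →. Y) : MultiFun X Y := fun x => {y | y ∈ f x}

/-- `F` is a realizer of `f` with respect to the representations `δX` and `δY`. -/
def IsRealizer {X Y : Type} (δX : BaireRepresentation X) (δY : BaireRepresentation Y)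
    (F : Baire →. Baire) (f : MultiFun X Y) : Prop :=
  ∀ p, ∀ x ∈ δX.toPFun p, x ∈ f.dom → ∃ q ∈ F p, ∃ y ∈ δY.toPFun q, y ∈ f x

/-- `f` is `(δX, δY)`-computable: it has a computable realizer. -/
def MultiFun.IsComputable {X Y : Type} (δX : BaireRepresentation X) (δY : BaireRepresentation Y)
    (f : MultiFun X Y) : Prop :=
  ∃ F : Baire →. Baire, BaireComputable F ∧ IsRealizer δX δY F f

/-- Strong Weihrauch reducibility `f ≤_sW g`: there are computable `K` and `H` such that
`K ∘ G ∘ H` is a realizer of `f` for every realizer `G` of `g`. -/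
def StrongWeihrauchLE {X Y U V : Type} (δX : BaireRepresentation X) (δY : BaireRepresentation Y)
    (δU : BaireRepresentation U) (δV : BaireRepresentation V) (f : MultiFun X Y) (g : MultiFun U V) : Prop :=
  ∃ K H : Baire →. Baire, BaireComputable K ∧ BaireComputable H ∧
    ∀ G : Baire →. Baire, IsRealizer δU δV G g → IsRealizer δX δY (K.comp (G.comp H)) f

/-- Baire space is represented by the identity. -/
def baireRep : BaireRepresentation Baire where
  toPFun p := Part.some p
  surj x := ⟨x, Part.mem_some x⟩

theorem Cantor.toBaire_injective : Function.Injective Cantor.toBaire := by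
  intro x y h
  funext n
  have := congrFun h n
  simp only [Cantor.toBaire] at this
  revert this
  cases x n <;> cases y n <;> simp

/-- Cantor space is represented by the identity of Baire space, restricted to the binary
sequences. -/
def cantorRep : BaireRepresentation Cantor where
  toPFun p := ⟨∃ x : Cantor, x.toBaire = p, fun h => h.choose⟩
  surj x := ⟨x.toBaire, ⟨x, rfl⟩, Cantor.toBaire_injective (Exists.choose_spec
    (⟨x, rfl⟩ : ∃ y : Cantor, y.toBaire = x.toBaire))⟩

theorem mem_cantorRep {p : Baire} {x : Cantor} : x ∈ cantorRep.toPFun p ↔ x.toBaire = p := by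
  constructor
  · rintro ⟨h, rfl⟩
    exact h.choose_spec
  · rintro rfl
    exact ⟨⟨x, rfl⟩, Cantor.toBaire_injective (Exists.choose_spec
      (⟨x, rfl⟩ : ∃ y : Cantor, y.toBaire = x.toBaire))⟩

/-! ### Limits, the Turing jump, low names -/

/-- The `i`-th component of `⟨p₀, p₁, p₂, …⟩`, where `⟨p₀, p₁, …⟩ ⟨i, k⟩ = pᵢ(k)`. -/
def component (p : Baire) (i : ℕ) : Baire := fun k => p (Nat.pair i k)

/-- The partial map `⟨p₀, p₁, p₂, …⟩ ↦ lim pᵢ` on Baire space. -/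
def baireLim : Baire →. Baire := fun p =>
  ⟨∃ q, Tendsto (component p) atTop (𝓝 q), fun h => h.choose⟩

theorem mem_baireLim {p q : Baire} : q ∈ baireLim p ↔ Tendsto (component p) atTop (𝓝 q) := by
  constructor
  · rintro ⟨h, rfl⟩
    exact h.choose_spec
  · intro h
    exact ⟨⟨q, h⟩, tendsto_nhds_unique (Exists.choose_spec
      (⟨q, h⟩ : ∃ q, Tendsto (component p) atTop (𝓝 q))) h⟩

/-- The standard enumeration of the c.e. open subsets of Baire space: the `n`-th one is the union
of the cylinders of the words in the `n`-th c.e. set of words (the domain of the `n`-th partial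
recursive function). -/
def ceOpen (n : ℕ) : Set Baire :=
  {p | ∃ w : List ℕ, ((Denumerable.ofNat Nat.Partrec.Code n).eval (encode w)).Dom ∧
    p ∈ wordCylinder w}

open Classical in
/-- The Turing jump operator. -/
def turingJump (p : Baire) : Baire := fun n => if p ∈ ceOpen n then 1 else 0

theorem exists_ceOpen_eq_wordCylinder (w : List ℕ) : ∃ n, ceOpen n = wordCylinder w := by
  have hpart : Nat.Partrec fun m => if m = encode w then Part.some 0 else Part.none := by
    refine Partrec.nat_iff.1 ?_
    have h : Partrec fun m : ℕ => ((if m = encode w then some 0 else none : Option ℕ) : Part ℕ) := by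
      refine Computable.ofOption ?_
      exact (Primrec.ite (Primrec.eq.comp Primrec.id (Primrec.const _)) (Primrec.const _)
        (Primrec.const _)).to_comp
    refine h.of_eq fun m => ?_
    split_ifs <;> rfl
  obtain ⟨c, hc⟩ := Nat.Partrec.Code.exists_code.1 hpart
  refine ⟨encode c, ?_⟩
  ext p
  simp only [ceOpen, Denumerable.ofNat_encode, hc, mem_ofPred_eq]
  constructor
  · rintro ⟨v, hv, hp⟩
    by_cases h : encode v = encode w
    · rwa [encode_injective h] at hp
    · simp [h] at hv
  · intro hp
    exact ⟨w, by simp, hp⟩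

theorem turingJump_injective : Function.Injective turingJump := by
  intro p q h
  funext n
  obtain ⟨m, hm⟩ := exists_ceOpen_eq_wordCylinder (initSeg p (n + 1))
  have hp : p ∈ ceOpen m := hm ▸ initSeg_mem p (n + 1)
  have hq : q ∈ ceOpen m := by
    by_contra hq
    have := congrFun h m
    simp [turingJump, hp, hq] at this
  rw [hm, mem_wordCylinder_initSeg] at hq
  exact (hq n (Nat.lt_succ_self n)).symm

/-- The partial inverse of the Turing jump. -/
def jumpInv : Baire →. Baire := fun q => ⟨∃ p, turingJump p = q, fun h => h.choose⟩

theorem mem_jumpInv {p q : Baire} : p ∈ jumpInv q ↔ turingJump p = q := by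
  constructor
  · rintro ⟨h, rfl⟩
    exact h.choose_spec
  · rintro rfl
    exact ⟨⟨p, rfl⟩, turingJump_injective (Exists.choose_spec
      (⟨p, rfl⟩ : ∃ p', turingJump p' = turingJump p))⟩

/-- The map `L = J⁻¹ ∘ lim`. -/
def lowMap : Baire →. Baire := jumpInv.comp baireLim

/-- The integral `δ ∘ J⁻¹` of a representation `δ`. -/
def BaireRepresentation.integral {X : Type} (δ : BaireRepresentation X) : BaireRepresentation X where
  toPFun := δ.toPFun.comp jumpInv
  surj x := by
    obtain ⟨p, hp⟩ := δ.surj x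
    refine ⟨turingJump p, ?_⟩
    rw [PFun.comp_apply]
    exact Part.mem_bind (mem_jumpInv.2 rfl) hp

/-- The derivative `δ' = δ ∘ lim` of a representation `δ`. -/
def BaireRepresentation.derivative {X : Type} (δ : BaireRepresentation X) : BaireRepresentation X where
  toPFun := δ.toPFun.comp baireLim
  surj x := by
    obtain ⟨p, hp⟩ := δ.surj x
    refine ⟨fun m => p m.unpair.2, ?_⟩
    rw [PFun.comp_apply]
    refine Part.mem_bind (mem_baireLim.2 ?_) hp
    have : component (fun m => p m.unpair.2) = fun _ => p := by
      funext i k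
      simp [component]
    rw [this]
    exact tendsto_const_nhds

/-- The low representation: the derivative of the integral. -/
def BaireRepresentation.low {X : Type} (δ : BaireRepresentation X) : BaireRepresentation X :=
  δ.integral.derivative

/-- `f` is low computable: it is computable with respect to `δX` and the low representation
of the target space. -/
def MultiFun.IsLowComputable {X Y : Type} (δX : BaireRepresentation X) (δY : BaireRepresentation Y)
    (f : MultiFun X Y) : Prop :=
  f.IsComputable δX δY.low

/-! ### Closed choice on Cantor space -/

/-- The closed set whose complement is enumerated by `p`: an entry `p i = encode w + 1` lists the
word `w`, and every other entry (such as `0`) lists nothing. -/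
def closedOfEnum (p : Baire) : Closeds Cantor where
  carrier := (⋃ (w : List Bool) (_ : ∃ i, p i = encode w + 1), wordCylinder w)ᶜ
  isClosed' := (isOpen_iUnion fun w => isOpen_iUnion fun _ => isOpen_wordCylinder w).isClosed_compl

open Classical in
/-- The negative information representation of the closed subsets of Cantor space: a name of `A`
is an enumeration of words whose cylinders exhaust the complement of `A`. -/
def negRep : BaireRepresentation (Closeds Cantor) where
  toPFun p := Part.some (closedOfEnum p)
  surj A := by
    refine ⟨fun i => if ∃ w : List Bool, encode w = i ∧ Disjoint (wordCylinder w) (A : Set Cantor)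
      then i + 1 else 0, ?_⟩
    rw [Part.mem_some_iff]
    symm
    ext x
    simp only [closedOfEnum, Closeds.coe_mk, mem_compl_iff, mem_iUnion,
      exists_prop, not_exists, not_and]
    constructor
    · intro h
      by_contra hx
      have hnhds : (A : Set Cantor)ᶜ ∈ 𝓝 x := A.isClosed.isOpen_compl.mem_nhds hx
      obtain ⟨s, ⟨y, k, rfl⟩, hxs, hs⟩ :=
        (PiNat.isTopologicalBasis_cylinders (fun _ => Bool)).mem_nhds_iff.1 hnhds
      refine h (initSeg x k) ⟨encode (initSeg x k), ?_⟩ (initSeg_mem x k)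
      rw [if_pos]
      refine ⟨initSeg x k, rfl, Set.disjoint_left.2 fun z hz => hs ?_⟩
      rw [mem_wordCylinder_initSeg] at hz
      exact fun i hi => (hz i hi).trans (hxs i hi)
    · rintro hx w ⟨i, hi⟩ hxw
      split_ifs at hi with h
      obtain ⟨v, hv, hd⟩ := h
      have hvw : v = w := encode_injective (hv.trans (Nat.succ_injective hi))
      subst hvw
      exact Set.disjoint_left.1 hd hxw hx

/-- Closed choice on Cantor space: a non-empty closed set is mapped to any of its points. -/
def cantorChoice : MultiFun (Closeds Cantor) Cantor := fun A => (A : Set Cantor)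

end

/-! The proof forces with closed sets. Let `V 0` be the complement of `A`; for each c.e. open set `U
n` in turn, put `V (n + 1) = V n ∪ U n` unless this union is all of Cantor space, and `V (n + 1) = V
n` otherwise. No `V n` is the whole space, so by compactness some `x` lies outside all of them. If
`V n ∪ U n` is the whole space, then `x ∈ U n`; if not, `U n ⊆ V (n + 1)` and `x ∉ U n`. Hence
`J(x)(n) = 1` exactly when `V n ∪ U n` is everything (`exists_tendsto_jumpGuess`).

By compactness, finitely many words witness a covering, so stage `s` tests whether the words found
so far cover. Early decisions may be wrong and are then revoked, but by induction on `n` the first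
`n` decisions stabilise (`approximates_forcingWords`), and the tests converge to `J(x)`. Each test
is primitive recursive in `s`, `n` and the first `s` entries of the name, which gives one computable
function for all names. Its output is a low name of `x`, and `L` maps it to `x`. -/

open Nat.Partrec (Code)

/-! ### Total functionals computed by an oracle machine -/

/-- A total functional `Baire × ℕ → ℕ` that an oracle machine computes. -/
def RecTotal (f : Baire → ℕ → ℕ) : Prop := RecFunctional fun p n => Part.some (f p n)

theorem RecFunctional.of_partrec {f : ℕ →. ℕ} (hf : Nat.Partrec f) :
    RecFunctional fun _ => f := by
  induction hf with
  | zero => exact .zero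
  | succ => exact .succ
  | left => exact .left
  | right => exact .right
  | pair _ _ hf hg => exact .pair hf hg
  | comp _ _ hf hg => exact .comp hf hg
  | prec _ _ hf hg => exact .prec hf hg
  | rfind _ hf => exact .rfind hf

theorem RecTotal.of_computable {f : ℕ → ℕ} (hf : Computable f) : RecTotal fun _ => f :=
  RecFunctional.of_partrec (Partrec.nat_iff.1 hf)

theorem RecTotal.oracle : RecTotal fun p n => p n := RecFunctional.oracle

theorem RecTotal.comp {f g : Baire → ℕ → ℕ} (hf : RecTotal f) (hg : RecTotal g) :
    RecTotal fun p n => f p (g p n) := by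
  have h := RecFunctional.comp hf hg
  simpa [RecTotal] using h

theorem RecTotal.pair {f g : Baire → ℕ → ℕ} (hf : RecTotal f) (hg : RecTotal g) :
    RecTotal fun p n => Nat.pair (f p n) (g p n) := by
  have h := RecFunctional.pair hf hg
  simpa [RecTotal, Seq.seq] using h

theorem RecTotal.prec {f g : Baire → ℕ → ℕ} (hf : RecTotal f) (hg : RecTotal g) :
    RecTotal fun p m => m.unpair.2.rec (f p m.unpair.1) fun y i =>
      g p (Nat.pair m.unpair.1 (Nat.pair y i)) := by
  have h := RecFunctional.prec hf hg
  refine (congrArg RecFunctional (funext₂ fun p m => ?_)).mp h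
  dsimp only
  induction m.unpair.2 with
  | zero => rfl
  | succ k ih => exact (congrArg (· >>= _) ih).trans (Part.bind_some _ _)

theorem RecTotal.encode_initSeg : RecTotal fun p n => encode (initSeg p n) := by
  have happ : Computable fun m : ℕ =>
      encode (((decode (α := List ℕ) m.unpair.1).getD []) ++ [m.unpair.2]) :=
    (Primrec.encode.comp (Primrec.list_append.comp
      (Primrec.option_getD.comp (Primrec.decode.comp (Primrec.fst.comp Primrec.unpair))
        (Primrec.const []))
      (Primrec.list_cons.comp (Primrec.snd.comp Primrec.unpair) (Primrec.const [])))).to_comp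
  have hproj : ∀ {f : ℕ → ℕ}, Primrec f → RecTotal fun _ => f := fun h => .of_computable h.to_comp
  -- The recursion carries the code of the prefix found so far; here `m` is `⟨a, ⟨k, code⟩⟩` with a
  -- dummy parameter `a`.
  have hstep : RecTotal fun p m =>
      encode (((decode (α := List ℕ) m.unpair.2.unpair.2).getD []) ++ [p m.unpair.2.unpair.1]) := by
    have h2 : Primrec fun m : ℕ => m.unpair.2.unpair :=
      Primrec.unpair.comp (Primrec.snd.comp Primrec.unpair)
    have h := (RecTotal.of_computable happ).comp
      ((hproj (Primrec.snd.comp h2)).pair (RecTotal.oracle.comp (hproj (Primrec.fst.comp h2))))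
    simpa only [Nat.unpair_pair] using h
  have hrec := (RecTotal.prec (hproj (Primrec.const (encode ([] : List ℕ)))) hstep).comp
    ((hproj (Primrec.const 0)).pair (hproj Primrec.id))
  convert hrec using 3 with p n
  simp only [id, Nat.unpair_pair]
  induction n with
  | zero => simp [initSeg]
  | succ k ih =>
    simp only [← ih, encodek, Option.getD_some]
    simp [initSeg, List.range_succ]

/-- The bridge from oracle machines to ordinary recursion theory: once a finite prefix of the oracle
is read, only a primitive recursive function of a list remains. -/
theorem RecTotal.of_initSeg {g : List ℕ → ℕ → ℕ} (hg : Primrec₂ g) :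
    RecTotal fun p m => g (initSeg p m.unpair.1) m := by
  have hg' : Computable fun m : ℕ => g ((decode (α := List ℕ) m.unpair.1).getD []) m.unpair.2 :=
    (hg.comp (Primrec.option_getD.comp (Primrec.decode.comp (Primrec.fst.comp Primrec.unpair))
      (Primrec.const [])) (Primrec.snd.comp Primrec.unpair)).to_comp
  have h := (RecTotal.of_computable hg').comp
    ((RecTotal.encode_initSeg.comp
      (RecTotal.of_computable (Primrec.fst.comp Primrec.unpair).to_comp)).pair
      (RecTotal.of_computable Computable.id))
  simpa [encodek] using h

theorem RecTotal.baireComputable {f : Baire → Baire} (hf : RecTotal f) :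
    BaireComputable fun p => Part.some (f p) :=
  ⟨_, hf, fun p q hq n => by rw [Part.mem_some_iff.1 hq]; exact Part.mem_some _⟩

/-! ### Finite lists of words and the part of Cantor space that they cover -/

/-- The points of Cantor space that extend the word `w`. -/
def cantorCylinder (w : List ℕ) : Set Cantor := Cantor.toBaire ⁻¹' wordCylinder w

theorem Cantor.continuous_toBaire : Continuous Cantor.toBaire :=
  continuous_pi fun n => continuous_of_discreteTopology.comp (continuous_apply n)

theorem isOpen_cantorCylinder (w : List ℕ) : IsOpen (cantorCylinder w) :=
  (isOpen_wordCylinder w).preimage Cantor.continuous_toBaire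

/-- Names of closed sets list Boolean words, c.e. open sets list words over `ℕ`. Translating the
former puts both kinds into one list. -/
theorem cantorCylinder_map_toNat (w : List Bool) :
    cantorCylinder (w.map Bool.toNat) = wordCylinder w := by
  ext x
  have h : initSeg x.toBaire w.length = (initSeg x w.length).map Bool.toNat := by
    simp [initSeg, Cantor.toBaire]
  have hinj : Function.Injective Bool.toNat := by decide
  simp only [cantorCylinder, mem_preimage, wordCylinder, mem_ofPred_eq, List.length_map, h]
  exact hinj.list_map.eq_iff

/-- The binary digits of `v` form a sequence that extends the word `w`. -/
def BitsExtend (w : List ℕ) (v : ℕ) : Prop :=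
  (List.range w.length).map (fun i => v / 2 ^ i % 2) = w

/-- Every binary word of length `s` extends a word in `l` of length at most `s`. -/
def Covers (s : ℕ) (l : List (List ℕ)) : Prop :=
  ∀ v < 2 ^ s, ∃ w ∈ l, w.length ≤ s ∧ BitsExtend w v

/-- A cylinder of a word of length at most `s` depends only on the first `s` digits of a point, and
the numbers below `2 ^ s` code all choices of these. Covering by such cylinders is thus a bounded
test. -/
theorem covers_iff {s : ℕ} {l : List (List ℕ)} :
    Covers s l ↔ ∀ x : Cantor, ∃ w ∈ l, w.length ≤ s ∧ x ∈ cantorCylinder w := by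
  have key : ∀ (x : Cantor) (v : ℕ), (∀ i < s, v.testBit i = x i) → ∀ w : List ℕ, w.length ≤ s →
      (BitsExtend w v ↔ x ∈ cantorCylinder w) := by
    intro x v hv w hw
    suffices h : (List.range w.length).map (fun i => v / 2 ^ i % 2) = initSeg x.toBaire w.length by
      rw [BitsExtend, h]; rfl
    refine List.map_congr_left fun i hi => ?_
    rw [← Nat.toNat_testBit, hv i ((List.mem_range.1 hi).trans_le hw), Cantor.toBaire]
  constructor
  · intro h x
    obtain ⟨w, hw, hws, hb⟩ := h (Nat.ofBits fun i : Fin s => x i) (Nat.ofBits_lt_two_pow _)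
    exact ⟨w, hw, hws, (key x _ (fun i hi => Nat.testBit_ofBits_lt _ i hi) w hws).1 hb⟩
  · intro h v _
    obtain ⟨w, hw, hws, hb⟩ := h fun i => v.testBit i
    exact ⟨w, hw, hws, (key _ v (fun _ _ => rfl) w hws).2 hb⟩

theorem primrec_two_pow : Primrec fun n : ℕ => 2 ^ n := by
  refine (Primrec.nat_rec₁ (f := fun _ m => m * 2) 1
    (Primrec.nat_mul.comp Primrec.snd (Primrec.const 2)).to₂).of_eq fun n => ?_
  induction n with
  | zero => rfl
  | succ k ih => rw [pow_succ, ← ih]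

theorem primrec_bitsExtend : PrimrecRel BitsExtend := by
  refine Primrec.eq.comp (Primrec.list_map
    (Primrec.list_range.comp (Primrec.list_length.comp Primrec.fst)) ?_) Primrec.fst
  exact (Primrec.nat_mod.comp (Primrec.nat_div.comp (Primrec.snd.comp Primrec.fst)
    (primrec_two_pow.comp Primrec.snd)) (Primrec.const 2)).to₂

theorem primrec_covers : PrimrecRel Covers := by
  have h1 : PrimrecRel fun (w : List ℕ) (b : ℕ × ℕ) => w.length ≤ b.1 ∧ BitsExtend w b.2 :=
    (Primrec.nat_le.comp (Primrec.list_length.comp Primrec.fst)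
      (Primrec.fst.comp Primrec.snd)).and
      (primrec_bitsExtend.comp Primrec.fst (Primrec.snd.comp Primrec.snd))
  have h2 := h1.exists_mem_list
  have h3 : PrimrecRel fun (v : ℕ) (a : ℕ × List (List ℕ)) =>
      ∃ w ∈ a.2, w.length ≤ a.1 ∧ BitsExtend w v :=
    h2.comp (Primrec.snd.comp Primrec.snd)
      (Primrec.pair (Primrec.fst.comp Primrec.snd) Primrec.fst)
  exact (h3.forall_mem_list.comp (Primrec.list_range.comp (primrec_two_pow.comp Primrec.fst))
    Primrec.id).of_eq fun a => by simp [Covers]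

/-! ### Approximations of open subsets of Cantor space -/

/-- The finite lists `l s` of words approximate the open set `V`: in the limit they list only
cylinders inside `V`, and every point of `V` is in a cylinder that is eventually listed. -/
structure Approximates (l : ℕ → List (List ℕ)) (V : Set Cantor) : Prop where
  sound : ∀ᶠ s in atTop, ∀ w ∈ l s, cantorCylinder w ⊆ V
  complete : ∀ x ∈ V, ∃ w, x ∈ cantorCylinder w ∧ ∀ᶠ s in atTop, w ∈ l s

namespace Approximates

variable {l l' : ℕ → List (List ℕ)} {V V' : Set Cantor}

theorem congr (h : Approximates l V) (hl : ∀ᶠ s in atTop, l' s = l s) : Approximates l' V where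
  sound := by
    filter_upwards [h.sound, hl] with s hs he
    rwa [he]
  complete x hx := by
    obtain ⟨w, hxw, hw⟩ := h.complete x hx
    refine ⟨w, hxw, ?_⟩
    filter_upwards [hw, hl] with s hs he
    rwa [he]

theorem append (h : Approximates l V) (h' : Approximates l' V') :
    Approximates (fun s => l s ++ l' s) (V ∪ V') where
  sound := by
    filter_upwards [h.sound, h'.sound] with s hs hs' w hw
    rcases List.mem_append.1 hw with hw | hw
    · exact (hs w hw).trans subset_union_left
    · exact (hs' w hw).trans subset_union_right
  complete x hx := by
    rcases hx with hx | hx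
    · obtain ⟨w, hxw, hw⟩ := h.complete x hx
      exact ⟨w, hxw, hw.mono fun s hs => List.mem_append_left _ hs⟩
    · obtain ⟨w, hxw, hw⟩ := h'.complete x hx
      exact ⟨w, hxw, hw.mono fun s hs => List.mem_append_right _ hs⟩

theorem isOpen (h : Approximates l V) : IsOpen V := by
  obtain ⟨s₀, hs₀⟩ := eventually_atTop.1 h.sound
  refine isOpen_iff_mem_nhds.2 fun x hx => ?_
  obtain ⟨w, hxw, hw⟩ := h.complete x hx
  obtain ⟨s, hws, hs⟩ := (hw.and (eventually_ge_atTop s₀)).exists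
  exact mem_of_superset ((isOpen_cantorCylinder w).mem_nhds hxw) (hs₀ s hs w hws)

/-- Compactness leaves finitely many cylinders, and their words are all listed from some stage on.
-/
theorem eventually_covers (h : Approximates l V) (hV : V = univ) :
    ∀ᶠ s in atTop, Covers s (l s) := by
  choose w hxw hw using fun x => h.complete x (hV ▸ mem_univ x)
  obtain ⟨t, ht⟩ := isCompact_univ.elim_finite_subcover (fun x => cantorCylinder (w x))
    (fun x => isOpen_cantorCylinder _) fun x _ => mem_iUnion.2 ⟨x, hxw x⟩
  -- `Covers s` ignores words longer than `s`, so the stage must also exceed their lengths.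
  have hev : ∀ᶠ s in atTop, ∀ x ∈ t, w x ∈ l s ∧ (w x).length ≤ s :=
    (eventually_all_finset t).2 fun x _ => (hw x).and (eventually_ge_atTop _)
  filter_upwards [hev] with s hs
  refine covers_iff.2 fun x => ?_
  obtain ⟨y, hyt, hxy⟩ := mem_iUnion₂.1 (ht (mem_univ x))
  exact ⟨w y, (hs y hyt).1, (hs y hyt).2, hxy⟩

theorem eventually_not_covers (h : Approximates l V) (hV : V ≠ univ) :
    ∀ᶠ s in atTop, ¬ Covers s (l s) := by
  filter_upwards [h.sound] with s hs hc
  refine hV (eq_univ_of_forall fun x => ?_)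
  obtain ⟨w, hw, -, hx⟩ := covers_iff.1 hc x
  exact hs w hw hx

end Approximates

/-! ### Approximating the given closed set and the c.e. open sets -/

/-- The words that the finite part `P` of a name of a closed set enumerates. -/
def negWords (P : List ℕ) : List (List ℕ) :=
  P.filterMap fun e => (decode₂ (List Bool) (e - 1)).bind fun w =>
    if e = 0 then none else some (w.map Bool.toNat)

theorem mem_negWords {P : List ℕ} {u : List ℕ} :
    u ∈ negWords P ↔ ∃ w : List Bool, encode w + 1 ∈ P ∧ w.map Bool.toNat = u := by
  simp only [negWords, List.mem_filterMap, Option.bind_eq_some_iff, decode₂_eq_some]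
  constructor
  · rintro ⟨e, he, w, hw, h⟩
    -- The entry `0` must list nothing, but truncated subtraction turns it into the code of the
    -- empty word, whose cylinder is the whole space; the test `e = 0` prevents this.
    split_ifs at h with h0
    refine ⟨w, ?_, by simpa using h⟩
    rwa [hw, Nat.sub_add_cancel (Nat.pos_of_ne_zero h0)]
  · rintro ⟨w, hw, h⟩
    exact ⟨_, hw, w, by simp, by simpa using h⟩

theorem primrec_negWords : Primrec negWords := by
  refine Primrec.listFilterMap Primrec.id (Primrec.option_bind
    (Primrec.decode₂.comp (Primrec.pred.comp Primrec.snd)) ?_)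
  exact (Primrec.ite (Primrec.eq.comp (Primrec.snd.comp Primrec.fst) (Primrec.const 0))
    (Primrec.const none)
    (Primrec.option_some.comp (Primrec.list_map Primrec.snd
      ((Primrec.dom_finite Bool.toNat).comp Primrec.snd).to₂))).to₂

theorem approximates_negWords (p : Baire) :
    Approximates (fun s => negWords (initSeg p s)) (closedOfEnum p : Set Cantor)ᶜ where
  sound := by
    refine Eventually.of_forall fun s u hu => ?_
    obtain ⟨w, hw, rfl⟩ := mem_negWords.1 hu
    obtain ⟨i, -, hi⟩ := List.mem_map.1 hw
    rw [cantorCylinder_map_toNat]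
    simp only [closedOfEnum, Closeds.coe_mk, compl_compl]
    exact subset_iUnion₂_of_subset w ⟨i, hi⟩ subset_rfl
  complete x hx := by
    simp only [closedOfEnum, Closeds.coe_mk, compl_compl, mem_iUnion] at hx
    obtain ⟨w, ⟨i, hi⟩, hxw⟩ := hx
    refine ⟨w.map Bool.toNat, by rwa [cantorCylinder_map_toNat], ?_⟩
    filter_upwards [eventually_gt_atTop i] with s hs
    exact mem_negWords.2 ⟨w, List.mem_map.2 ⟨i, List.mem_range.2 hs, hi⟩, rfl⟩

/-- The words that the `n`-th c.e. open set lists within `s` steps. -/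
def ceWords (n s : ℕ) : List (List ℕ) :=
  (List.range s).filterMap fun m =>
    (Code.evaln s (Denumerable.ofNat Code n) m).bind fun _ => decode₂ (List ℕ) m

theorem mem_ceWords {n s : ℕ} {w : List ℕ} :
    w ∈ ceWords n s ↔ ∃ y, y ∈ Code.evaln s (Denumerable.ofNat Code n) (encode w) := by
  simp only [ceWords, List.mem_filterMap, Option.bind_eq_some_iff, Option.mem_def,
    decode₂_eq_some]
  constructor
  · rintro ⟨m, -, y, hy, hm⟩
    exact ⟨y, hm ▸ hy⟩
  · rintro ⟨y, hy⟩
    -- A computation that halts within bound `s` has input below `s`, so searching `List.range s`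
    -- misses nothing.
    exact ⟨encode w, List.mem_range.2 (Code.evaln_bound hy), y, hy, rfl⟩

theorem primrec_ceWords : Primrec₂ ceWords := by
  refine Primrec.listFilterMap (Primrec.list_range.comp Primrec.snd) (Primrec.option_bind
    (Code.primrec_evaln.comp (Primrec.pair (Primrec.pair (Primrec.snd.comp Primrec.fst)
      ((Primrec.ofNat Code).comp (Primrec.fst.comp Primrec.fst))) Primrec.snd)) ?_)
  exact (Primrec.decode₂.comp (Primrec.snd.comp Primrec.fst)).to₂

theorem approximates_ceWords (n : ℕ) :
    Approximates (ceWords n) (Cantor.toBaire ⁻¹' ceOpen n) where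
  sound := by
    refine Eventually.of_forall fun s w hw x hx => ?_
    obtain ⟨y, hy⟩ := mem_ceWords.1 hw
    exact ⟨w, Part.dom_iff_mem.2 ⟨y, Code.evaln_sound hy⟩, hx⟩
  complete x hx := by
    obtain ⟨w, hw, hxw⟩ := hx
    obtain ⟨y, hy⟩ := Part.dom_iff_mem.1 hw
    obtain ⟨k, hk⟩ := Code.evaln_complete.1 hy
    refine ⟨w, hxw, ?_⟩
    filter_upwards [eventually_ge_atTop k] with s hs
    exact mem_ceWords.2 ⟨y, Code.evaln_mono hs hk⟩

/-! ### The forcing construction and its finite stages -/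

open Classical in
/-- The complements of the closed sets in the construction of a low point: the `n`-th c.e. open set
is added unless the union would be all of Cantor space. -/
def forcingOpen (V : Set Cantor) : ℕ → Set Cantor
  | 0 => V
  | n + 1 =>
    if forcingOpen V n ∪ Cantor.toBaire ⁻¹' ceOpen n = univ then forcingOpen V n
    else forcingOpen V n ∪ Cantor.toBaire ⁻¹' ceOpen n

open Classical in
/-- The guess at stage `s` about the words that exhaust `forcingOpen V n`, where `l` lists the words
found in `V` so far. -/
noncomputable def forcingWords (l : List (List ℕ)) (s : ℕ) : ℕ → List (List ℕ)
  | 0 => l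
  | n + 1 =>
    if Covers s (forcingWords l s n ++ ceWords n s) then forcingWords l s n
    else forcingWords l s n ++ ceWords n s

open Classical in
/-- The guess at stage `s` about the `n`-th value of the jump of the low point. -/
noncomputable def jumpGuess (l : List (List ℕ)) (s n : ℕ) : ℕ :=
  if Covers s (forcingWords l s n ++ ceWords n s) then 1 else 0

/-- Once the guesses at level `n` approximate correctly, the covering test eventually agrees with
the true case distinction, so level `n + 1` eventually follows the right branch. -/
theorem approximates_forcingWords {l : ℕ → List (List ℕ)} {V : Set Cantor} (h : Approximates l V)
    (n : ℕ) : Approximates (fun s => forcingWords (l s) s n) (forcingOpen V n) := by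
  induction n with
  | zero => exact h
  | succ n ih =>
    have hn := ih.append (approximates_ceWords n)
    rw [forcingOpen]
    split_ifs with hV
    · exact ih.congr ((hn.eventually_covers hV).mono fun s hs => if_pos hs)
    · exact hn.congr ((hn.eventually_not_covers hV).mono fun s hs => if_neg hs)

theorem forcingOpen_ne_univ {V : Set Cantor} (hV : V ≠ univ) (n : ℕ) : forcingOpen V n ≠ univ := by
  induction n with
  | zero => exact hV
  | succ n ih =>
    rw [forcingOpen]
    split_ifs with h
    exacts [ih, h]

theorem forcingOpen_subset_succ (V : Set Cantor) (n : ℕ) :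
    forcingOpen V n ⊆ forcingOpen V (n + 1) := by
  rw [forcingOpen]
  split_ifs
  exacts [subset_rfl, subset_union_left]

/-- A point outside all `forcingOpen V n` has the jump that the guesses converge to. -/
theorem exists_tendsto_jumpGuess {l : ℕ → List (List ℕ)} {V : Set Cantor} (h : Approximates l V)
    (hV : V ≠ univ) :
    ∃ x ∉ V, Tendsto (fun s => jumpGuess (l s) s) atTop (𝓝 (turingJump x.toBaire)) := by
  have hcl : ∀ n, IsClosed (forcingOpen V n)ᶜ := fun n =>
    (approximates_forcingWords h n).isOpen.isClosed_compl
  -- Cantor's intersection theorem for the decreasing non-empty closed complements.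
  obtain ⟨x, hx⟩ := IsCompact.nonempty_iInter_of_sequence_nonempty_isCompact_isClosed
    (fun n => (forcingOpen V n)ᶜ) (fun n => compl_subset_compl.2 (forcingOpen_subset_succ V n))
    (fun n => nonempty_compl.2 (forcingOpen_ne_univ hV n)) (hcl 0).isCompact hcl
  have hx' : ∀ n, x ∉ forcingOpen V n := mem_iInter.1 hx
  refine ⟨x, hx' 0, tendsto_pi_nhds.2 fun n => tendsto_nhds_of_eventually_eq ?_⟩
  have hn := (approximates_forcingWords h n).append (approximates_ceWords n)
  by_cases hU : forcingOpen V n ∪ Cantor.toBaire ⁻¹' ceOpen n = univ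
  · have hxU : x.toBaire ∈ ceOpen n := (hU ▸ mem_univ x).resolve_left (hx' n)
    filter_upwards [hn.eventually_covers hU] with s hs
    rw [jumpGuess, if_pos hs, turingJump, if_pos hxU]
  · have hxU : x.toBaire ∉ ceOpen n := fun hmem => hx' (n + 1) <| by
      rw [forcingOpen, if_neg hU]
      exact Or.inr hmem
    filter_upwards [hn.eventually_not_covers hU] with s hs
    rw [jumpGuess, if_neg hs, turingJump, if_neg hxU]

/-! ### Computability of the guesses -/

theorem primrec_forcingWords :
    Primrec fun a : (List (List ℕ) × ℕ) × ℕ => forcingWords a.1.1 a.1.2 a.2 := by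
  classical
  have happ : Primrec fun b : (List (List ℕ) × ℕ) × ℕ × List (List ℕ) =>
      b.2.2 ++ ceWords b.2.1 b.1.2 :=
    Primrec.list_append.comp (Primrec.snd.comp Primrec.snd)
      (primrec_ceWords.comp (Primrec.fst.comp Primrec.snd) (Primrec.snd.comp Primrec.fst))
  have hstep : Primrec₂ fun (a : List (List ℕ) × ℕ) (b : ℕ × List (List ℕ)) =>
      if Covers a.2 (b.2 ++ ceWords b.1 a.2) then b.2 else b.2 ++ ceWords b.1 a.2 :=
    (Primrec.ite (primrec_covers.comp (Primrec.snd.comp Primrec.fst) happ)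
      (Primrec.snd.comp Primrec.snd) happ).to₂
  refine Primrec.of_eq (Primrec.nat_rec Primrec.fst hstep) fun a => ?_
  obtain ⟨⟨l, s⟩, n⟩ := a
  induction n with
  | zero => rfl
  | succ n ih => simp only at ih; simp only [ih, forcingWords]

theorem primrec_jumpGuess :
    Primrec fun a : (List (List ℕ) × ℕ) × ℕ => jumpGuess a.1.1 a.1.2 a.2 := by
  classical
  exact Primrec.ite (primrec_covers.comp (Primrec.snd.comp Primrec.fst)
    (Primrec.list_append.comp primrec_forcingWords
      (primrec_ceWords.comp Primrec.snd (Primrec.snd.comp Primrec.fst))))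
    (Primrec.const 1) (Primrec.const 0)

/-- The function that maps an enumeration of the complement of a closed set to the guesses about
the jump of one of its points. -/
noncomputable def lowBasis (p : Baire) : Baire := fun m =>
  jumpGuess (negWords (initSeg p m.unpair.1)) m.unpair.1 m.unpair.2

theorem recTotal_lowBasis : RecTotal lowBasis := by
  have h : Primrec₂ fun (P : List ℕ) (m : ℕ) =>
      jumpGuess (negWords P) m.unpair.1 m.unpair.2 :=
    (primrec_jumpGuess.comp (Primrec.pair (Primrec.pair (primrec_negWords.comp Primrec.fst)
      (Primrec.fst.comp (Primrec.unpair.comp Primrec.snd)))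
      (Primrec.snd.comp (Primrec.unpair.comp Primrec.snd)))).to₂
  exact RecTotal.of_initSeg h

theorem exists_tendsto_component_lowBasis {p : Baire}
    (hp : (closedOfEnum p : Set Cantor).Nonempty) :
    ∃ x ∈ closedOfEnum p,
      Tendsto (component (lowBasis p)) atTop (𝓝 (turingJump x.toBaire)) := by
  obtain ⟨x, hx, hlim⟩ := exists_tendsto_jumpGuess (approximates_negWords p)
    (fun h => hp.ne_empty (compl_univ_iff.1 h))
  refine ⟨x, not_not.1 hx, ?_⟩
  convert hlim using 1
  funext s n
  simp [component, lowBasis]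

/-! ### Low names, the map `L`, and the main theorem -/

theorem PFun.mem_comp_iff {α β γ : Type*} {f : β →. γ} {g : α →. β} {x : α} {z : γ} :
    z ∈ f.comp g x ↔ ∃ y ∈ g x, z ∈ f y := by
  rw [PFun.comp_apply]
  exact Part.mem_bind_iff

theorem mem_lowMap {p q : Baire} :
    p ∈ lowMap q ↔ Tendsto (component q) atTop (𝓝 (turingJump p)) := by
  simp only [lowMap, PFun.mem_comp_iff, mem_baireLim, mem_jumpInv]
  constructor
  · rintro ⟨r, hr, rfl⟩
    exact hr
  · exact fun h => ⟨_, h, rfl⟩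

theorem BaireRepresentation.mem_low {X : Type} (δ : BaireRepresentation X) {q : Baire} {x : X} :
    x ∈ δ.low.toPFun q ↔ ∃ p ∈ lowMap q, x ∈ δ.toPFun p := by
  simp only [low, derivative, integral, lowMap, PFun.mem_comp_iff]
  constructor
  · rintro ⟨r, hr, p, hp, hx⟩
    exact ⟨p, ⟨r, hr, hp⟩, hx⟩
  · rintro ⟨p, ⟨r, hr, hp⟩, hx⟩
    exact ⟨r, hr, p, hp, hx⟩

theorem mainTheorem1 :
    -- closed choice on Cantor space is low computable
    cantorChoice.IsLowComputable negRep cantorRep ∧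
    -- one computable function sends each enumeration of the complement of a non-empty closed `A`
    -- to a sequence that converges to the Turing jump of a point of `A`
    (∃ F : Baire →. Baire, BaireComputable F ∧
      ∀ p : Baire, (closedOfEnum p : Set Cantor).Nonempty →
        ∃ q ∈ F p, ∃ x ∈ closedOfEnum p,
          Tendsto (component q) atTop (𝓝 (turingJump x.toBaire))) ∧
    -- closed choice on Cantor space is strongly Weihrauch reducible to `J⁻¹ ∘ lim`
    StrongWeihrauchLE negRep cantorRep baireRep baireRep cantorChoice lowMap.toMultiFun := by
  refine ⟨⟨_, recTotal_lowBasis.baireComputable, ?_⟩,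
    ⟨_, recTotal_lowBasis.baireComputable, fun p hp =>
      ⟨_, Part.mem_some _, exists_tendsto_component_lowBasis hp⟩⟩,
    -- For the reduction, `K` is the identity and `H` is `lowBasis`.
    ⟨_, _, RecTotal.oracle.baireComputable, recTotal_lowBasis.baireComputable, ?_⟩⟩
  · intro p A hA hne
    obtain rfl := Part.mem_some_iff.1 hA
    obtain ⟨x, hx, hlim⟩ := exists_tendsto_component_lowBasis hne
    exact ⟨_, Part.mem_some _, x,
      (BaireRepresentation.mem_low _).2 ⟨_, mem_lowMap.2 hlim, mem_cantorRep.2 rfl⟩, hx⟩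
  · intro G hG p A hA hne
    obtain rfl := Part.mem_some_iff.1 hA
    obtain ⟨x, hx, hlim⟩ := exists_tendsto_component_lowBasis hne
    have hmem : x.toBaire ∈ lowMap (lowBasis p) := mem_lowMap.2 hlim
    obtain ⟨q, hq, y, hy, hyx⟩ := hG (lowBasis p) _ (Part.mem_some _) ⟨_, hmem⟩
    obtain rfl := Part.mem_some_iff.1 hy
    -- Since `L` is single-valued, every realizer must return this very point.
    obtain rfl := Part.mem_unique hyx hmem
    refine ⟨x.toBaire, ?_, x, mem_cantorRep.2 rfl, hx⟩
    exact PFun.mem_comp_iff.2 ⟨_, PFun.mem_comp_iff.2 ⟨_, Part.mem_some _, hq⟩, Part.mem_some _⟩
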